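/- Let $K$ be a field, let $q\in K$ satisfy $q^m\neq 1$ for all $m\ge 1$, and let $z\in K$, $z\ne 0$ (for instance, $z$ and $q$ independent indeterminates and $K=\mathbb{Q}(z,q)$). Write $(q;q)_m=\prod_{k=1}^m(1-q^k)$, and for integers $A,B$ put $$\begin{bmatrix}A\\B\end{bmatrix}_q=\frac{(q;q)_A}{(q;q)_B\,(q;q)_{A-B}}\ \text{ if } 0\le B\le A,\qquad \begin{bmatrix}A\\B\end{bmatrix}_q=0\ \text{ otherwise.}$$ For $n\ge 0$ let $$P_n=\sum_{j=0}^{\lfloor n/2\rfloor}\sum_{h=0}^{j}\sum_{i=0}^{j+1}(-1)^{h+i}z^{h-i}q^{\binom h2+\binom{i+1}2+j(j+1)}\begin{bmatrix}j\\h\end{bmatrix}_q\begin{bmatrix}j+1\\i\end{bmatrix}_q\begin{bmatrix}j+1+\lfloor\frac{n-h-i}2\rfloor\\2j+1\end{bmatrix}_q .$$ (a) For every $n\ge 0$, $$P_n=\sum_{j=-\infty}^{\infty}(-1)^jz^jq^{j(3j+1)/2}\begin{bmatrix}n\\\lfloor\frac{n+3j+2}2\rfloor\end{bmatrix}_q+\epsilon_n(z,q),$$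 where $$\epsilon_n(z,q)=\sum_{j=-\infty}^{\infty}z^{2j}q^{6j^2-2j+\frac n2}\begin{bmatrix}n\\\frac n2+3j\end{bmatrix}_q\ \text{ if } n \text{ is even,}$$ $$\epsilon_n(z,q)=-\sum_{j=-\infty}^{\infty}z^{2j+1}q^{6j^2+4j+\frac12+\frac n2}\begin{bmatrix}n\\\frac{n+6j+3}2\end{bmatrix}_q\ \text{ if } n \text{ is odd,}$$ and all these bilateral sums have only finitely many nonzero terms. (b) The sequence $(P_n)_{n\ge0}$ is the unique sequence in $K$ that satisfies, for all $n\ge 4$, $$P_n=(1-q)P_{n-1}+(2q+q^n)P_{n-2}+\bigl(q^2-q-(zq^2+z^{-1}q^3)q^{n-3}\bigr)P_{n-3}+(q^{n-1}-q^2)P_{n-4}$$ and has the initial values $$P_0=1,\quad P_1=1-\frac qz,\quad P_2=1+(1-z^{-1})q+q^2,$$ $$P_3=1+(1-z^{-1})q+(1-z-z^{-1})q^2-\frac{q^3}z-\frac{q^4}z .$$ -/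

import Mathlib

/-- The finite rising `q`-factorial `(a; q)_n = (1 - a)(1 - a q) ⋯ (1 - a q^(n-1))`. -/
def qPoch {K : Type*} [Field K] (a q : K) (n : ℕ) : K :=
  ∏ k ∈ Finset.range n, (1 - a * q ^ k)

/-- The `q`-binomial coefficient `[A, B]_q` with integer entries:
`(q;q)_A / ((q;q)_B (q;q)_{A-B})` if `0 ≤ B ≤ A`, and `0` otherwise. -/
def qbin {K : Type*} [Field K] (q : K) (A B : ℤ) : K :=
  if 0 ≤ B ∧ B ≤ A then
    qPoch q q A.toNat / (qPoch q q B.toNat * qPoch q q (A - B).toNat)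
  else 0

/-- The triple sum. The division of integers by `2` below is the floor of the quotient
(`n - h - i` may be negative). -/
def tripleSum {K : Type*} [Field K] (z q : K) (n : ℕ) : K :=
  ∑ j ∈ Finset.range (n / 2 + 1), ∑ h ∈ Finset.range (j + 1), ∑ i ∈ Finset.range (j + 2),
    (-1) ^ (h + i) * z ^ ((h : ℤ) - (i : ℤ))
      * q ^ (Nat.choose h 2 + Nat.choose (i + 1) 2 + j * (j + 1))
      * qbin q (j : ℤ) (h : ℤ) * qbin q ((j : ℤ) + 1) (i : ℤ)
      * qbin q ((j : ℤ) + 1 + ((n : ℤ) - (h : ℤ) - (i : ℤ)) / 2) (2 * (j : ℤ) + 1)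

/-- The `j`-th term of the main bilateral sum; `j (3 j + 1)` is even, and the lower entry of the
`q`-binomial coefficient is a floor. -/
def mainTerm {K : Type*} [Field K] (z q : K) (n : ℕ) (j : ℤ) : K :=
  (-1) ^ j * z ^ j * q ^ (j * (3 * j + 1) / 2) * qbin q (n : ℤ) (((n : ℤ) + 3 * j + 2) / 2)

/-- The `j`-th term of the correction for even `n`. -/
def evenTerm {K : Type*} [Field K] (z q : K) (n : ℕ) (j : ℤ) : K :=
  z ^ (2 * j) * q ^ (6 * j ^ 2 - 2 * j + (n : ℤ) / 2) * qbin q (n : ℤ) ((n : ℤ) / 2 + 3 * j)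

/-- The `j`-th term of the correction for odd `n`, up to the sign; both quotients by `2` are exact
for such `n`. -/
def oddTerm {K : Type*} [Field K] (z q : K) (n : ℕ) (j : ℤ) : K :=
  z ^ (2 * j + 1) * q ^ (6 * j ^ 2 + 4 * j + (1 + (n : ℤ)) / 2)
    * qbin q (n : ℤ) (((n : ℤ) + 6 * j + 3) / 2)

/-- The correction `ε_n(z, q)`. -/
noncomputable def epsilonCorr {K : Type*} [Field K] (z q : K) (n : ℕ) : K :=
  if Even n then ∑ᶠ j : ℤ, evenTerm z q n j else -∑ᶠ j : ℤ, oddTerm z q n j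

/-- The fourth-order recurrence, for all indices `n + 4 ≥ 4`, together with the initial values. -/
structure SatisfiesRecurrence {K : Type*} [Field K] (z q : K) (P : ℕ → K) : Prop where
  init0 : P 0 = 1
  init1 : P 1 = 1 - q / z
  init2 : P 2 = 1 + (1 - z⁻¹) * q + q ^ 2
  init3 : P 3 = 1 + (1 - z⁻¹) * q + (1 - z - z⁻¹) * q ^ 2 - q ^ 3 / z - q ^ 4 / z
  recur : ∀ n : ℕ, P (n + 4) =
    (1 - q) * P (n + 3) + (2 * q + q ^ (n + 4)) * P (n + 2)
      + (q ^ 2 - q - (z * q ^ 2 + z⁻¹ * q ^ 3) * q ^ (n + 1)) * P (n + 1)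
      + (q ^ (n + 3) - q ^ 2) * P n

/-!
Both sides of the closed formula satisfy the fourth-order recurrence with the same initial values,
and such a sequence is unique (`SatisfiesRecurrence.unique`).

For the triple sum, the `q`-binomial theorem (`prod_one_sub_C_mul_X`) and the expansion of
`(1 + X) / (X²; q)_(m+1)` (`mk_qbin_mul_prod`) identify its generating function with
`∑ j, q^(j(j+1)) X^(2j) (1 + X) (zX; q)_j (qX/z; q)_(j+1) / (X²; q)_(2j+2)`.
The substitution `X ↦ qX` carries each summand to the next one, up to a rational factor independent
of `j` (`genSummand_succ`), so the generating function `F` satisfies the `q`-difference equation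
`(1 - X)(1 - qX²)(1 + qX) F(X) = (1 + qX)(1 - qX/z) + q²X² (1 - zX)(1 - qX/z) F(qX)`
(`mk_tripleSum_eq`). The recurrence and the initial values are its coefficients.

For the closed form with `q ≠ 0`, the `q`-Pascal rule absorbs the correction into the main sum: the
term in `z ^ k` becomes `(-1)^k q^(k(3k+1)/2)` times `[n + 1, (n+3k+2)/2]` if `n + k` is even and
`[n, (n+3k+1)/2]` if `n + k` is odd (`closedTerm`, `finsum_closedTerm_eq`). In each power of `z`,
and for either parity, the recurrence then reduces to one identity between Gaussian binomials,
`qbin_three_step`. For `q = 0`, which the hypotheses allow, the closed form is constantly `1`, and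
so is the solution of the recurrence.
-/

/-! ### Gaussian binomial coefficients with integer entries -/

section GaussianBinomial

variable {K : Type*} [Field K] {q : K}

lemma qPoch_zero (a q : K) : qPoch a q 0 = 1 := Finset.prod_range_zero _

lemma qPoch_succ (a q : K) (n : ℕ) : qPoch a q (n + 1) = qPoch a q n * (1 - a * q ^ n) :=
  Finset.prod_range_succ _ _

lemma qPoch_self_ne_zero (hq : ∀ m : ℕ, 0 < m → q ^ m ≠ 1) (n : ℕ) : qPoch q q n ≠ 0 := by
  refine Finset.prod_ne_zero_iff.mpr fun k _ h => hq (k + 1) k.succ_pos ?_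
  rw [pow_succ']
  exact (sub_eq_zero.mp h).symm

lemma qbin_natCast_add (q : K) (a b : ℕ) :
    qbin q ((a + b : ℕ) : ℤ) (a : ℤ) = qPoch q q (a + b) / (qPoch q q a * qPoch q q b) := by
  have h : (((a + b : ℕ) : ℤ) - a).toNat = b := by omega
  rw [qbin, if_pos (by omega), h, Int.toNat_natCast, Int.toNat_natCast]

lemma qbin_eq_zero {A B : ℤ} (h : ¬(0 ≤ B ∧ B ≤ A)) : qbin q A B = 0 := if_neg h

lemma qbin_zero_right (hq : ∀ m : ℕ, 0 < m → q ^ m ≠ 1) {A : ℤ} (hA : 0 ≤ A) :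
    qbin q A 0 = 1 := by
  obtain ⟨a, rfl⟩ := Int.eq_ofNat_of_zero_le hA
  have := qbin_natCast_add q 0 a
  rw [Nat.zero_add] at this
  rw [← Nat.cast_zero (R := ℤ), this, qPoch_zero, one_mul, div_self (qPoch_self_ne_zero hq a)]

lemma qbin_self (hq : ∀ m : ℕ, 0 < m → q ^ m ≠ 1) {A : ℤ} (hA : 0 ≤ A) : qbin q A A = 1 := by
  obtain ⟨a, rfl⟩ := Int.eq_ofNat_of_zero_le hA
  have := qbin_natCast_add q a 0
  rw [Nat.add_zero] at this
  rw [this, qPoch_zero, mul_one, div_self (qPoch_self_ne_zero hq a)]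

lemma one_sub_zpow_mul_qbin (hq : ∀ m : ℕ, 0 < m → q ^ m ≠ 1) {A : ℤ} (hA : 1 ≤ A) (B : ℤ) :
    (1 - q ^ B) * qbin q A B = (1 - q ^ A) * qbin q (A - 1) (B - 1) := by
  by_cases h : 1 ≤ B ∧ B ≤ A
  · obtain ⟨a, rfl⟩ : ∃ a : ℕ, B = a + 1 := ⟨(B - 1).toNat, by omega⟩
    obtain ⟨b, rfl⟩ : ∃ b : ℕ, A = ((a + b : ℕ) : ℤ) + 1 := ⟨(A - 1 - a).toNat, by omega⟩
    have e : ((a + b : ℕ) : ℤ) + 1 = ((a + 1 + b : ℕ) : ℤ) := by push_cast; ring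
    rw [add_sub_cancel_right, add_sub_cancel_right, qbin_natCast_add, e,
      show (a : ℤ) + 1 = ((a + 1 : ℕ) : ℤ) by push_cast; rfl, qbin_natCast_add, zpow_natCast,
      zpow_natCast, show a + 1 + b = a + b + 1 by ring, qPoch_succ, qPoch_succ, ← pow_succ',
      ← pow_succ']
    have h1 := qPoch_self_ne_zero hq a
    have h2 := qPoch_self_ne_zero hq b
    have h3 : 1 - q ^ (a + 1) ≠ 0 := sub_ne_zero.mpr (hq _ a.succ_pos).symm
    field_simp
  · rw [qbin_eq_zero (A := A - 1) (by omega), mul_zero]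
    rcases eq_or_ne B 0 with rfl | hB
    · simp
    · rw [qbin_eq_zero (by omega), mul_zero]

lemma qbin_symm (A B : ℤ) : qbin q A (A - B) = qbin q A B := by
  unfold qbin
  rw [sub_sub_cancel, mul_comm]
  exact if_congr (by omega) rfl rfl

lemma one_sub_zpow_sub_mul_qbin (hq : ∀ m : ℕ, 0 < m → q ^ m ≠ 1) {A : ℤ} (hA : 1 ≤ A) (B : ℤ) :
    (1 - q ^ (A - B)) * qbin q A B = (1 - q ^ A) * qbin q (A - 1) B := by
  rw [← qbin_symm A B, one_sub_zpow_mul_qbin hq hA, ← qbin_symm (A - 1) B]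
  congr 2
  ring

/-- The `q`-Pascal rule. For `q = 0` it relies on `0 ^ (A - B)` only where `A - B ≥ 0`, because
the second coefficient on the right vanishes otherwise. -/
lemma qbin_eq_add_zpow_sub_mul (hq : ∀ m : ℕ, 0 < m → q ^ m ≠ 1) {A : ℤ} (hA : 1 ≤ A) (B : ℤ) :
    qbin q A B = qbin q (A - 1) B + q ^ (A - B) * qbin q (A - 1) (B - 1) := by
  by_cases hB : 0 ≤ B ∧ B ≤ A
  · obtain ⟨a, rfl⟩ := Int.eq_ofNat_of_zero_le hB.1
    obtain ⟨b, rfl⟩ : ∃ b : ℕ, A = (a : ℤ) + b := ⟨(A - a).toNat, by omega⟩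
    have hne : 1 - q ^ (a + b) ≠ 0 := sub_ne_zero.mpr (hq _ (by omega)).symm
    have h1 := one_sub_zpow_mul_qbin hq hA (a : ℤ)
    have h2 := one_sub_zpow_sub_mul_qbin hq hA (a : ℤ)
    rw [add_sub_cancel_left] at h2 ⊢
    rw [← Nat.cast_add] at h1 h2 ⊢
    simp only [zpow_natCast, pow_add] at *
    apply mul_left_cancel₀ hne
    linear_combination h2 + q ^ b * h1
  · rw [qbin_eq_zero hB, qbin_eq_zero (A := A - 1) (by omega),
      qbin_eq_zero (A := A - 1) (by omega)]
    simp

lemma qbin_eq_zpow_mul_add (hq : ∀ m : ℕ, 0 < m → q ^ m ≠ 1) {A : ℤ} (hA : 1 ≤ A) (B : ℤ) :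
    qbin q A B = q ^ B * qbin q (A - 1) B + qbin q (A - 1) (B - 1) := by
  have h := qbin_eq_add_zpow_sub_mul hq hA (A - B)
  rw [qbin_symm, sub_sub_cancel, ← qbin_symm (A - 1) (A - B), ← qbin_symm (A - 1) (A - B - 1),
    show A - 1 - (A - B) = B - 1 by ring, show A - 1 - (A - B - 1) = B by ring] at h
  rw [h, add_comm]

/-- The relation between Gaussian binomials that makes the closed form satisfy the fourth-order
recurrence. With `x = B`, `y = A - B` and `[x, y] = qbin q (x + y) x`, it reads
`[x, y] = (1 + q + q^(A-1)) [x-1, y-1] + (q^(A-2) - q) [x-2, y-2]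
  + q^(2y) [x-3, y] + q^(2x) [x, y-3]`. -/
lemma qbin_three_step (hq : ∀ m : ℕ, 0 < m → q ^ m ≠ 1) (hq0 : q ≠ 0) {A : ℤ} (hA : 4 ≤ A)
    (B : ℤ) :
    qbin q A B = (1 + q + q ^ (A - 1)) * qbin q (A - 2) (B - 1)
      + (q ^ (A - 2) - q) * qbin q (A - 4) (B - 2)
      + q ^ (2 * (A - B)) * qbin q (A - 3) (B - 3) + q ^ (2 * B) * qbin q (A - 3) B := by
  obtain ⟨x, rfl⟩ : ∃ x, B = x + 2 := ⟨B - 2, by ring⟩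
  obtain ⟨y, rfl⟩ : ∃ y, A = x + y + 4 := ⟨A - x - 4, by ring⟩
  -- After this shift every coefficient is a polynomial in `q`, `q ^ x` and `q ^ y`. The rules
  -- `h1`, ..., `h6` reduce the claim to one about `[x, y + 1]`, `[x + 1, y + 1]` and `[x, y]`, and
  -- that one follows from the absorption rules `h7` and `h8`.
  have h1 := qbin_eq_add_zpow_sub_mul hq (A := x + y + 4) (by omega) (x + 2)
  have h2 := qbin_eq_add_zpow_sub_mul hq (A := x + y + 3) (by omega) (x + 1)
  have h3 := qbin_eq_zpow_mul_add hq (A := x + y + 2) (by omega) x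
  have h4 := qbin_eq_zpow_mul_add hq (A := x + y + 3) (by omega) (x + 2)
  have h5 := qbin_eq_zpow_mul_add hq (A := x + y + 2) (by omega) (x + 2)
  have h6 := qbin_eq_add_zpow_sub_mul hq (A := x + y + 2) (by omega) (x + 1)
  have h7 := one_sub_zpow_sub_mul_qbin hq (A := x + y + 1) (by omega) x
  have h8 := one_sub_zpow_mul_qbin hq (A := x + y + 2) (by omega) (x + 1)
  ring_nf at h1 h2 h3 h4 h5 h6 h7 h8 ⊢
  simp only [zpow_add₀ hq0, zpow_mul, zpow_ofNat] at *
  linear_combination h1 + q ^ y * q ^ 2 * h2 + (q ^ y * q ^ 2) ^ 2 * h3 + h4 + q ^ x * q ^ 2 * h5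
    - q ^ x * q ^ 2 * h6 - q ^ x * q ^ y * q ^ 3 * h7 - q * (1 - q ^ y * q) * h8
    - q * (1 - q ^ x * q ^ y * q ^ 2) * h7

end GaussianBinomial

/-! ### The generating function of the triple sum -/

section GeneratingFunction

open PowerSeries

variable {K : Type*} [Field K] {q : K}

/-- The `q`-binomial theorem: `(c X; q)_j` expanded in powers of `X`. -/
lemma prod_one_sub_C_mul_X (hq : ∀ m : ℕ, 0 < m → q ^ m ≠ 1) (c : K) (j : ℕ) :
    ∏ i ∈ Finset.range j, (1 - C (c * q ^ i) * X : K⟦X⟧) =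
      ∑ h ∈ Finset.range (j + 1),
        C ((-1) ^ h * c ^ h * q ^ Nat.choose h 2 * qbin q j h) * X ^ h := by
  suffices H : ∀ n, coeff n (∏ i ∈ Finset.range j, (1 - C (c * q ^ i) * X : K⟦X⟧)) =
      (-1) ^ n * c ^ n * q ^ Nat.choose n 2 * qbin q j n by
    ext n
    simp only [H, map_sum, coeff_C_mul_X_pow, Finset.sum_ite_eq, Finset.mem_range]
    split_ifs with h
    · rfl
    · rw [qbin_eq_zero (by omega), mul_zero]
  induction j with
  | zero =>
    rintro (_ | n)
    · simp [qbin_self hq]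
    · simp [coeff_one, qbin_eq_zero (q := q) (A := 0) (B := (n : ℤ) + 1) (by omega)]
  | succ j ih =>
    intro n
    rw [Finset.prod_range_succ, mul_sub, mul_one, map_sub, ih, mul_left_comm, coeff_C_mul]
    rcases n with _ | n
    · simp [qbin_zero_right hq (show (0 : ℤ) ≤ j + 1 by omega), qbin_zero_right hq]
    · rw [coeff_succ_mul_X, ih]
      push_cast
      rw [qbin_eq_add_zpow_sub_mul hq (A := (j : ℤ) + 1) (by omega), add_sub_add_right_eq_sub,
        add_sub_cancel_right, add_sub_cancel_right]
      rcases le_or_gt n j with h | h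
      · obtain ⟨d, rfl⟩ := Nat.exists_eq_add_of_le h
        rw [Nat.choose_succ_succ' n 1, Nat.choose_one_right]
        push_cast
        rw [add_sub_cancel_left, zpow_natCast]
        ring
      · rw [qbin_eq_zero (B := (n : ℤ)) (by omega)]
        ring

/-- `(1 + X) / (X²; q)_{m+1}` is the series `∑ k, [m + ⌊k/2⌋, m] X ^ k`. -/
lemma mk_qbin_mul_prod (hq : ∀ m : ℕ, 0 < m → q ^ m ≠ 1) (m : ℕ) :
    (mk fun k : ℕ => qbin q (m + (k : ℤ) / 2) m) *
      ∏ i ∈ Finset.range (m + 1), (1 - C (q ^ i) * X ^ 2 : K⟦X⟧) = 1 + X := by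
  induction m with
  | zero =>
    rw [Finset.prod_range_one]
    ext k
    rw [mul_sub, mul_one, mul_left_comm, map_sub, coeff_C_mul, coeff_mul_X_pow']
    rcases k with _ | _ | k
    · simp [qbin_self hq]
    · simp [qbin_self hq, coeff_one, coeff_X]
    · rw [if_pos (by omega), coeff_mk, coeff_mk]
      push_cast
      rw [qbin_zero_right hq (by omega), qbin_zero_right hq (by omega)]
      simp [coeff_one, coeff_X]
  | succ m ih =>
    rw [Finset.prod_range_succ, mul_comm (∏ i ∈ _, _), ← mul_assoc, ← ih]
    congr 1
    ext k
    rw [mul_sub, mul_one, mul_left_comm, map_sub, coeff_C_mul, coeff_mul_X_pow']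
    rcases Nat.lt_or_ge k 2 with hk | hk
    · have : (k : ℤ) / 2 = 0 := by omega
      rw [if_neg (by omega), coeff_mk, coeff_mk, this, add_zero, add_zero, qbin_self hq (by omega),
        qbin_self hq (by omega)]
      simp
    · obtain ⟨k, rfl⟩ := Nat.exists_eq_add_of_le' hk
      have e : (((k + 2 : ℕ) : ℤ)) / 2 = (k : ℤ) / 2 + 1 := by omega
      rw [if_pos hk, Nat.add_sub_cancel, coeff_mk, coeff_mk, coeff_mk, e,
        qbin_eq_zpow_mul_add hq (by omega), zpow_natCast]
      push_cast
      rw [show (m : ℤ) + 1 + ((k : ℤ) / 2 + 1) - 1 = m + 1 + (k : ℤ) / 2 by ring,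
        add_sub_cancel_right, show (m : ℤ) + ((k : ℤ) / 2 + 1) = m + 1 + (k : ℤ) / 2 by ring]
      ring

/-- The series `∑ k, [j + 1 + ⌊k/2⌋, 2j + 1] X ^ k`, which equals
`X ^ (2j) (1 + X) / (X²; q)_{2j+2}`. -/
def floorSeries (q : K) (j : ℕ) : K⟦X⟧ :=
  mk fun k : ℕ => qbin q ((j : ℤ) + 1 + (k : ℤ) / 2) (2 * (j : ℤ) + 1)

lemma floorSeries_mul_prod (hq : ∀ m : ℕ, 0 < m → q ^ m ≠ 1) (j : ℕ) :
    floorSeries q j * ∏ i ∈ Finset.range (2 * j + 2), (1 - C (q ^ i) * X ^ 2 : K⟦X⟧) =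
      X ^ (2 * j) * (1 + X) := by
  rw [← mk_qbin_mul_prod hq (2 * j + 1), ← mul_assoc]
  congr 1
  ext k
  rw [floorSeries, coeff_X_pow_mul', coeff_mk]
  split_ifs with h
  · obtain ⟨k, rfl⟩ := Nat.exists_eq_add_of_le' h
    rw [Nat.add_sub_cancel, coeff_mk]
    push_cast
    congr 1
    omega
  · exact qbin_eq_zero (by omega)

lemma one_sub_C_mul_X_pow_ne_zero (a : K) (n : ℕ) : (1 - C a * X ^ (n + 1) : K⟦X⟧) ≠ 0 := by
  intro h
  simpa using congrArg (coeff 0) h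

lemma rescale_C_apply (a b : K) : rescale a (C b : K⟦X⟧) = C b := by
  ext n
  rcases n with _ | n <;> simp [coeff_C]

lemma floorSeries_succ (hq : ∀ m : ℕ, 0 < m → q ^ m ≠ 1) (j : ℕ) :
    C (q ^ (2 * j)) * floorSeries q (j + 1) * (1 - X) * (1 - C q * X ^ 2) * (1 + C q * X) =
      X ^ 2 * rescale q (floorSeries q j) := by
  have h0 := congrArg (rescale q) (floorSeries_mul_prod hq j)
  have h1 := floorSeries_mul_prod hq (j + 1)
  rw [show 2 * (j + 1) + 2 = (2 * j + 2) + 1 + 1 by ring, Finset.prod_range_succ',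
    Finset.prod_range_succ'] at h1
  simp only [map_mul, map_prod, map_sub, map_add, map_one, map_pow, rescale_X,
    rescale_C_apply] at h0 h1 ⊢
  have e : ∀ i, (1 - C q ^ i * (C q * X) ^ 2 : K⟦X⟧) = 1 - C q ^ (i + 1 + 1) * X ^ 2 :=
    fun i => by ring
  simp only [e] at h0
  -- Multiply by the common denominator, then by `1 + X`, to compare without inverses.
  have hP : ∏ i ∈ Finset.range (2 * j + 2), (1 - C q ^ (i + 1 + 1) * X ^ 2 : K⟦X⟧) ≠ 0 :=
    Finset.prod_ne_zero_iff.mpr fun i _ => by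
      rw [← map_pow]
      exact one_sub_C_mul_X_pow_ne_zero _ 1
  have hX : (1 + X : K⟦X⟧) ≠ 0 := fun h => by simpa using congrArg (coeff 0) h
  apply mul_left_cancel₀ hP
  apply mul_left_cancel₀ hX
  linear_combination C q ^ (2 * j) * (1 + C q * X) * h1 - (1 + X) * X ^ 2 * h0

/-- The summand of index `j` of the generating function of the triple sum:
`q^(j(j+1)) (zX; q)_j (qX/z; q)_{j+1} X^(2j) (1 + X) / (X²; q)_{2j+2}`. -/
noncomputable def genSummand (z q : K) (j : ℕ) : K⟦X⟧ :=
  C (q ^ (j * (j + 1))) * (∏ i ∈ Finset.range j, (1 - C (z * q ^ i) * X)) *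
    (∏ i ∈ Finset.range (j + 1), (1 - C (z⁻¹ * q * q ^ i) * X)) * floorSeries q j

lemma coeff_genSummand {z : K} (hz : z ≠ 0) (hq : ∀ m : ℕ, 0 < m → q ^ m ≠ 1) (n j : ℕ) :
    coeff n (genSummand z q j) = ∑ h ∈ Finset.range (j + 1), ∑ i ∈ Finset.range (j + 2),
      (-1) ^ (h + i) * z ^ ((h : ℤ) - (i : ℤ))
        * q ^ (Nat.choose h 2 + Nat.choose (i + 1) 2 + j * (j + 1))
        * qbin q (j : ℤ) (h : ℤ) * qbin q ((j : ℤ) + 1) (i : ℤ)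
        * qbin q ((j : ℤ) + 1 + ((n : ℤ) - (h : ℤ) - (i : ℤ)) / 2) (2 * (j : ℤ) + 1) := by
  rw [genSummand, prod_one_sub_C_mul_X hq, prod_one_sub_C_mul_X hq, mul_assoc, mul_assoc,
    coeff_C_mul, Finset.sum_mul, map_sum, Finset.mul_sum]
  refine Finset.sum_congr rfl fun h _ => ?_
  rw [Finset.sum_mul, Finset.mul_sum, map_sum, Finset.mul_sum]
  refine Finset.sum_congr rfl fun i _ => ?_
  rw [mul_assoc (C _) (X ^ i), mul_mul_mul_comm, ← mul_assoc (X ^ h), ← pow_add, ← map_mul,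
    coeff_C_mul, coeff_X_pow_mul']
  have hfloor : (if h + i ≤ n then coeff (n - (h + i)) (floorSeries q j) else 0) =
      qbin q ((j : ℤ) + 1 + ((n : ℤ) - (h : ℤ) - (i : ℤ)) / 2) (2 * (j : ℤ) + 1) := by
    split_ifs with hn
    · rw [floorSeries, coeff_mk]
      congr 1
      omega
    · exact (qbin_eq_zero (by omega)).symm
  rw [hfloor, zpow_sub₀ hz, zpow_natCast, zpow_natCast, Nat.choose_succ_succ' i 1,
    Nat.choose_one_right]
  simp only [mul_pow, inv_pow]
  push_cast
  field_simp
  ring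

/-- The triple sum may be extended over any longer range of `j`, since `X ^ (2j)` divides the
summand of index `j`. -/
lemma coeff_sum_genSummand {z : K} (hz : z ≠ 0) (hq : ∀ m : ℕ, 0 < m → q ^ m ≠ 1) {n N : ℕ}
    (h : n / 2 < N) : coeff n (∑ j ∈ Finset.range N, genSummand z q j) = tripleSum z q n := by
  rw [map_sum, tripleSum]
  simp only [← coeff_genSummand hz hq]
  refine (Finset.sum_subset (Finset.range_subset_range.mpr h) fun j _ hj => ?_).symm
  rw [Finset.mem_range, not_lt] at hj
  rw [coeff_genSummand hz hq]
  refine Finset.sum_eq_zero fun h _ => Finset.sum_eq_zero fun i _ => ?_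
  rw [qbin_eq_zero (A := (j : ℤ) + 1 + _) (by omega), mul_zero]

lemma genSummand_zero (hq : ∀ m : ℕ, 0 < m → q ^ m ≠ 1) (z : K) :
    (1 - X) * (1 - C q * X ^ 2) * (1 + C q * X) * genSummand z q 0 =
      (1 + C q * X) * (1 - C (z⁻¹ * q) * X) := by
  have hX : (1 + X : K⟦X⟧) ≠ 0 := fun h => by simpa using congrArg (coeff 0) h
  have h := floorSeries_mul_prod hq 0
  simp only [Finset.prod_range_succ, Finset.prod_range_zero, pow_zero, pow_one, mul_zero, zero_add,
    map_one, one_mul] at h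
  apply mul_left_cancel₀ hX
  simp only [genSummand, Finset.prod_range_zero, Finset.prod_range_one, pow_zero, mul_one,
    map_one, one_mul, zero_add]
  linear_combination (1 + C q * X) * (1 - C (z⁻¹ * q) * X) * h

lemma prod_succ_eq_mul_rescale (c q : K) (j : ℕ) :
    ∏ i ∈ Finset.range (j + 1), (1 - C (c * q ^ i) * X : K⟦X⟧) =
      (1 - C c * X) * rescale q (∏ i ∈ Finset.range j, (1 - C (c * q ^ i) * X)) := by
  rw [Finset.prod_range_succ', mul_comm, pow_zero, mul_one, map_prod]
  congr 1
  refine Finset.prod_congr rfl fun i _ => ?_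
  simp only [map_sub, map_one, map_mul, rescale_X, rescale_C_apply, map_pow]
  ring

/-- Passing from one summand to the next amounts to the substitution `X ↦ q X`, up to a rational
factor that does not depend on `j`. -/
lemma genSummand_succ (hq : ∀ m : ℕ, 0 < m → q ^ m ≠ 1) (z : K) (j : ℕ) :
    (1 - X) * (1 - C q * X ^ 2) * (1 + C q * X) * genSummand z q (j + 1) =
      C (q ^ 2) * X ^ 2 * (1 - C z * X) * (1 - C (z⁻¹ * q) * X) *
        rescale q (genSummand z q j) := by
  have h := floorSeries_succ hq j
  rw [genSummand, genSummand, prod_succ_eq_mul_rescale z, prod_succ_eq_mul_rescale _ q (j + 1)]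
  simp only [map_mul (rescale q), rescale_C_apply, map_pow] at h ⊢
  linear_combination C q ^ (j * (j + 1) + 2) * (1 - C z * X) * (1 - C (z⁻¹ * q) * X) *
    rescale q (∏ i ∈ Finset.range j, (1 - C (z * q ^ i) * X)) *
    rescale q (∏ i ∈ Finset.range (j + 1), (1 - C (z⁻¹ * q * q ^ i) * X)) * h

/-- The `q`-difference equation of the generating function, for truncated sums. -/
lemma sum_genSummand_eq (hq : ∀ m : ℕ, 0 < m → q ^ m ≠ 1) (z : K) (N : ℕ) :
    (1 - X) * (1 - C q * X ^ 2) * (1 + C q * X) *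
        ∑ j ∈ Finset.range (N + 1), genSummand z q j =
      (1 + C q * X) * (1 - C (z⁻¹ * q) * X) + C (q ^ 2) * X ^ 2 * (1 - C z * X) *
        (1 - C (z⁻¹ * q) * X) * rescale q (∑ j ∈ Finset.range N, genSummand z q j) := by
  rw [Finset.sum_range_succ', mul_add, genSummand_zero hq, add_comm, Finset.mul_sum, map_sum,
    Finset.mul_sum]
  simp only [genSummand_succ hq]

/-- The `q`-difference equation of the generating function. -/
lemma mk_tripleSum_eq {z : K} (hz : z ≠ 0) (hq : ∀ m : ℕ, 0 < m → q ^ m ≠ 1) :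
    (1 - X) * (1 - C q * X ^ 2) * (1 + C q * X) * mk (tripleSum z q) =
      (1 + C q * X) * (1 - C (z⁻¹ * q) * X) + C (q ^ 2) * X ^ 2 * (1 - C z * X) *
        (1 - C (z⁻¹ * q) * X) * rescale q (mk (tripleSum z q)) := by
  ext n
  have h := congrArg (coeff n) (sum_genSummand_eq hq z (n + 1))
  -- The coefficients of index at most `n` do not see the truncation at `N > n`.
  have e : ∀ N, n < N → ∀ m ≤ n, coeff m (∑ j ∈ Finset.range N, genSummand z q j) =
      coeff m (mk (tripleSum z q)) := fun N hN m hm => by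
    rw [coeff_sum_genSummand hz hq (by omega), coeff_mk]
  have e1 : ∀ (f g g' : K⟦X⟧), (∀ m ≤ n, coeff m g = coeff m g') →
      coeff n (f * g) = coeff n (f * g') := fun f g g' hg => by
    simp only [coeff_mul]
    exact Finset.sum_congr rfl fun p hp => by rw [hg _ (by
      have := Finset.HasAntidiagonal.mem_antidiagonal.mp hp
      omega)]
  rw [map_add] at h ⊢
  rw [e1 _ _ _ (e (n + 1 + 1) (by omega)), e1 _ (rescale q _) (rescale q (mk (tripleSum z q)))
    fun m hm => by rw [coeff_rescale, coeff_rescale, e (n + 1) (by omega) m hm]] at h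
  exact h

/-- Comparing coefficients in the `q`-difference equation gives the recurrence and the initial
values. -/
theorem tripleSum_satisfiesRecurrence {z : K} (hz : z ≠ 0) (hq : ∀ m : ℕ, 0 < m → q ^ m ≠ 1) :
    SatisfiesRecurrence z q (tripleSum z q) := by
  set F : K⟦X⟧ := mk (tripleSum z q) with hF
  -- The functional equation with both rational factors expanded in powers of `X`.
  have key : F = X * (C (1 - q) * F) + X * (X * (C (2 * q) * F)) +
      X * (X * (X * (C (q ^ 2 - q) * F))) - X * (X * (X * (X * (C (q ^ 2) * F)))) +
      (1 + X * C (q - z⁻¹ * q) + X * (X * C (-(z⁻¹ * q ^ 2)))) +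
      (X * (X * (C (q ^ 2) * rescale q F)) -
        X * (X * (X * (C (q ^ 2 * z + q ^ 3 * z⁻¹) * rescale q F))) +
        X * (X * (X * (X * (C (q ^ 3) * rescale q F))))) := by
    have hzz : C z * C z⁻¹ = (1 : K⟦X⟧) := by rw [← map_mul, mul_inv_cancel₀ hz, map_one]
    have h := mk_tripleSum_eq hz hq
    rw [← hF] at h
    simp only [map_sub, map_add, map_mul, map_pow, map_one, map_ofNat, map_neg] at h ⊢
    linear_combination h + C q ^ 3 * X ^ 4 * rescale q F * hzz
  have c0 := congrArg (coeff 0) key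
  have c1 := congrArg (coeff (0 + 1)) key
  have c2 := congrArg (coeff (0 + 1 + 1)) key
  have c3 := congrArg (coeff (0 + 1 + 1 + 1)) key
  have c4 := fun n => congrArg (coeff (n + 1 + 1 + 1 + 1)) key
  simp only [map_add, map_sub, map_one, add_mul, sub_mul, one_mul, coeff_succ_X_mul,
    coeff_zero_X_mul, coeff_C_mul, coeff_one, coeff_C,
    coeff_rescale, hF, coeff_mk, Nat.add_eq_zero_iff, one_ne_zero, and_false, if_false, if_true,
    zero_add, add_zero, sub_zero, pow_zero, pow_one] at c0 c1 c2 c3 c4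
  norm_num only at c1 c2 c3 c4
  simp only [and_false, if_false, add_zero, sub_zero] at c4
  refine ⟨c0, ?_, ?_, ?_, fun n => ?_⟩
  · rw [c1, c0]
    field_simp
    ring
  · rw [c2, c1, c0]
    field_simp
    ring
  · rw [c3, c2, c1, c0]
    field_simp
    ring
  · rw [c4]
    ring

end GeneratingFunction

/-! ### The closed form -/

section ClosedForm

variable {K : Type*} [Field K] {q : K}

/-- The coefficient of the Gaussian binomials in the `k`-th term of the closed form. -/
def closedCoeff (z q : K) (k : ℤ) : K := (-1) ^ k * z ^ k * q ^ (k * (3 * k + 1) / 2)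

/-- The full term in `z ^ k` of the closed form, after the correction has been absorbed into the
main bilateral sum by the `q`-Pascal rule. -/
def closedTerm (z q : K) (n : ℕ) (k : ℤ) : K :=
  closedCoeff z q k * qbin q (if Even ((n : ℤ) + k) then (n : ℤ) + 1 else n)
    (((n : ℤ) + 3 * k + 2) / 2)

lemma closedTerm_of_even (z q : K) {n : ℕ} {k m : ℤ} (h : (n : ℤ) + k = 2 * m) :
    closedTerm z q n k = closedCoeff z q k * qbin q ((n : ℤ) + 1) (m + k + 1) := by
  rw [closedTerm, if_pos (h ▸ even_two_mul m)]
  congr 2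
  omega

lemma closedTerm_of_odd (z q : K) {n : ℕ} {k m : ℤ} (h : (n : ℤ) + k = 2 * m + 1) :
    closedTerm z q n k = closedCoeff z q k * qbin q n (m + k + 1) := by
  rw [closedTerm, if_neg (by rw [h, Int.not_even_iff_odd]; exact odd_two_mul_add_one m)]
  congr 2
  omega

lemma two_mul_pentagonal (k : ℤ) : 2 * (k * (3 * k + 1) / 2) = k * (3 * k + 1) := by
  refine Int.mul_ediv_cancel' (even_iff_two_dvd.mp ?_)
  rcases Int.even_or_odd k with h | h
  · exact h.mul_right _
  · exact (((by decide : Odd (3 : ℤ)).mul h).add_odd odd_one).mul_left _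

lemma closedCoeff_sub_one {z : K} (hz : z ≠ 0) (hq0 : q ≠ 0) (k a : ℤ) :
    z * q ^ a * closedCoeff z q (k - 1) = -(q ^ (a + 1 - 3 * k) * closedCoeff z q k) := by
  have e : (k - 1) * (3 * (k - 1) + 1) / 2 = k * (3 * k + 1) / 2 + (1 - 3 * k) := by
    have h1 := two_mul_pentagonal (k - 1)
    have h2 := two_mul_pentagonal k
    linarith
  rw [closedCoeff, closedCoeff, e, zpow_sub_one₀ (by norm_num : (-1 : K) ≠ 0), zpow_sub_one₀ hz,
    zpow_add₀ hq0, add_sub_assoc, zpow_add₀ hq0 a, inv_neg, inv_one]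
  field_simp

lemma closedCoeff_add_one {z : K} (hz : z ≠ 0) (hq0 : q ≠ 0) (k a : ℤ) :
    z⁻¹ * q ^ a * closedCoeff z q (k + 1) = -(q ^ (a + 2 + 3 * k) * closedCoeff z q k) := by
  have e : (k + 1) * (3 * (k + 1) + 1) / 2 = k * (3 * k + 1) / 2 + (2 + 3 * k) := by
    have h1 := two_mul_pentagonal (k + 1)
    have h2 := two_mul_pentagonal k
    linarith
  rw [closedCoeff, closedCoeff, e, zpow_add_one₀ (by norm_num : (-1 : K) ≠ 0), zpow_add_one₀ hz,
    zpow_add₀ hq0, add_assoc, zpow_add₀ hq0 a]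
  field_simp

/-- The recurrence, read off in each power of `z`. For both parities of `n + k` it is an instance
of `qbin_three_step`. -/
lemma closedTerm_recurrence {z : K} (hz : z ≠ 0) (hq : ∀ m : ℕ, 0 < m → q ^ m ≠ 1) (hq0 : q ≠ 0)
    (n : ℕ) (k : ℤ) :
    closedTerm z q (n + 4) k = (1 - q) * closedTerm z q (n + 3) k
      + (2 * q + q ^ (n + 4)) * closedTerm z q (n + 2) k
      + (q ^ 2 - q) * closedTerm z q (n + 1) k
      - z * q ^ (n + 3) * closedTerm z q (n + 1) (k - 1)
      - z⁻¹ * q ^ (n + 4) * closedTerm z q (n + 1) (k + 1)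
      + (q ^ (n + 3) - q ^ 2) * closedTerm z q n k := by
  have h1 := closedCoeff_sub_one hz hq0 k ((n + 3 : ℕ) : ℤ)
  have h2 := closedCoeff_add_one hz hq0 k ((n + 4 : ℕ) : ℤ)
  rw [zpow_natCast] at h1 h2
  rcases Int.even_or_odd' ((n : ℤ) + k) with ⟨m, h | h⟩
  · rw [closedTerm_of_even z q (n := n + 4) (k := k) (m := m + 2) (by push_cast; omega),
      closedTerm_of_odd z q (n := n + 3) (k := k) (m := m + 1) (by push_cast; omega),
      closedTerm_of_even z q (n := n + 2) (k := k) (m := m + 1) (by push_cast; omega),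
      closedTerm_of_odd z q (n := n + 1) (k := k) (m := m) (by push_cast; omega),
      closedTerm_of_even z q (n := n + 1) (k := k - 1) (m := m) (by push_cast; omega),
      closedTerm_of_even z q (n := n + 1) (k := k + 1) (m := m + 1) (by push_cast; omega),
      closedTerm_of_even z q h]
    have h3 := qbin_three_step hq hq0 (A := (n : ℤ) + 5) (by omega) (m + k + 3)
    rw [show 2 * ((n : ℤ) + 5 - (m + k + 3)) = ((n + 3 : ℕ) : ℤ) + 1 - 3 * k by push_cast; omega,
      show 2 * (m + k + 3) = ((n + 4 : ℕ) : ℤ) + 2 + 3 * k by push_cast; omega,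
      show (n : ℤ) + 5 - 1 = ((n + 4 : ℕ) : ℤ) by push_cast; ring,
      show (n : ℤ) + 5 - 2 = ((n + 3 : ℕ) : ℤ) by push_cast; ring,
      zpow_natCast, zpow_natCast] at h3
    push_cast at h1 h2 h3 ⊢
    ring_nf at h1 h2 h3 ⊢
    linear_combination closedCoeff z q k * h3 + qbin q (2 + (n : ℤ)) (k + m) * h1 +
      qbin q (2 + (n : ℤ)) (3 + k + m) * h2
  · rw [closedTerm_of_odd z q (n := n + 4) (k := k) (m := m + 2) (by push_cast; omega),
      closedTerm_of_even z q (n := n + 3) (k := k) (m := m + 2) (by push_cast; omega),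
      closedTerm_of_odd z q (n := n + 2) (k := k) (m := m + 1) (by push_cast; omega),
      closedTerm_of_even z q (n := n + 1) (k := k) (m := m + 1) (by push_cast; omega),
      closedTerm_of_odd z q (n := n + 1) (k := k - 1) (m := m) (by push_cast; omega),
      closedTerm_of_odd z q (n := n + 1) (k := k + 1) (m := m + 1) (by push_cast; omega),
      closedTerm_of_odd z q h]
    have h3 := qbin_three_step hq hq0 (A := (n : ℤ) + 4) (by omega) (m + k + 3)
    have e1 : q * q ^ (2 * ((n : ℤ) + 4 - (m + k + 3))) = q ^ (((n + 3 : ℕ) : ℤ) + 1 - 3 * k) := by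
      rw [← zpow_one_add₀ hq0]
      congr 1
      push_cast
      omega
    have e2 : q * q ^ (2 * (m + k + 3)) = q ^ (((n + 4 : ℕ) : ℤ) + 2 + 3 * k) := by
      rw [← zpow_one_add₀ hq0]
      congr 1
      push_cast
      omega
    rw [← e1] at h1
    rw [← e2] at h2
    rw [show (n : ℤ) + 4 - 1 = ((n + 3 : ℕ) : ℤ) by push_cast; ring,
      show (n : ℤ) + 4 - 2 = ((n + 2 : ℕ) : ℤ) by push_cast; ring,
      zpow_natCast, zpow_natCast] at h3
    generalize q ^ (2 * ((n : ℤ) + 4 - (m + k + 3))) = u at *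
    generalize q ^ (2 * (m + k + 3)) = v at *
    push_cast at h3 ⊢
    ring_nf at h1 h2 h3 ⊢
    linear_combination q * closedCoeff z q k * h3 + qbin q (1 + (n : ℤ)) (k + m) * h1 +
      qbin q (1 + (n : ℤ)) (3 + k + m) * h2

lemma closedTerm_support_subset (z q : K) (n : ℕ) :
    Function.support (closedTerm z q n) ⊆ Finset.Icc (-((n : ℤ) / 3 + 1)) ((n : ℤ) / 3 + 1) := by
  intro k hk
  by_contra h
  rw [Finset.coe_Icc, Set.mem_Icc] at h
  refine hk ?_
  rw [closedTerm, qbin_eq_zero (by split_ifs <;> omega), mul_zero]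

theorem finsum_closedTerm_recurrence {z : K} (hz : z ≠ 0) (hq : ∀ m : ℕ, 0 < m → q ^ m ≠ 1)
    (hq0 : q ≠ 0) (n : ℕ) :
    ∑ᶠ k, closedTerm z q (n + 4) k = (1 - q) * ∑ᶠ k, closedTerm z q (n + 3) k
      + (2 * q + q ^ (n + 4)) * ∑ᶠ k, closedTerm z q (n + 2) k
      + (q ^ 2 - q - (z * q ^ 2 + z⁻¹ * q ^ 3) * q ^ (n + 1)) * ∑ᶠ k, closedTerm z q (n + 1) k
      + (q ^ (n + 3) - q ^ 2) * ∑ᶠ k, closedTerm z q n k := by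
  have hN : ∀ m ≤ n + 4, ∀ c : ℤ, |c| ≤ 1 → ∑ᶠ k, closedTerm z q m k =
      ∑ k ∈ Finset.Icc (-((n : ℤ) + 10)) ((n : ℤ) + 10), closedTerm z q m (k + c) := by
    intro m hm c hc
    rw [← finsum_comp_equiv (Equiv.addRight c)]
    refine finsum_eq_finsetSum_of_support_subset _ fun k hk => ?_
    have := closedTerm_support_subset z q m (show k + c ∈ _ from hk)
    rw [Finset.coe_Icc, Set.mem_Icc] at this ⊢
    rw [abs_le] at hc
    omega
  have h0 : ∀ m ≤ n + 4, ∑ᶠ k, closedTerm z q m k =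
      ∑ k ∈ Finset.Icc (-((n : ℤ) + 10)) ((n : ℤ) + 10), closedTerm z q m k := fun m hm => by
    simpa using hN m hm 0 (by norm_num)
  have hp := hN (n + 1) (by omega) 1 (by norm_num)
  have hm := hN (n + 1) (by omega) (-1) (by norm_num)
  simp only [← sub_eq_add_neg] at hm
  have e : (q ^ 2 - q - (z * q ^ 2 + z⁻¹ * q ^ 3) * q ^ (n + 1)) * ∑ᶠ k, closedTerm z q (n + 1) k =
      (q ^ 2 - q) * ∑ᶠ k, closedTerm z q (n + 1) k
      - z * q ^ (n + 3) * ∑ᶠ k, closedTerm z q (n + 1) k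
      - z⁻¹ * q ^ (n + 4) * ∑ᶠ k, closedTerm z q (n + 1) k := by ring
  -- Reindex the two sums multiplied by `z` and `z⁻¹`, so that all terms carry the
  -- same power of `z`.
  rw [e]
  nth_rewrite 2 [hm]
  nth_rewrite 2 [hp]
  rw [h0 (n + 4) le_rfl, h0 (n + 3) (by omega), h0 (n + 2) (by omega), h0 (n + 1) (by omega),
    h0 n (by omega)]
  simp only [closedTerm_recurrence hz hq hq0, Finset.mul_sum, Finset.sum_add_distrib,
    Finset.sum_sub_distrib]
  ring

lemma closedCoeff_zero (z q : K) : closedCoeff z q 0 = 1 := by simp [closedCoeff]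

lemma closedCoeff_one (z q : K) : closedCoeff z q 1 = -(z * q ^ 2) := by
  rw [closedCoeff, show (1 : ℤ) * (3 * 1 + 1) / 2 = 2 by norm_num]
  simp [zpow_ofNat]

lemma closedCoeff_neg_one (z q : K) : closedCoeff z q (-1) = -(z⁻¹ * q) := by
  rw [closedCoeff, show (-1 : ℤ) * (3 * -1 + 1) / 2 = 1 by norm_num]
  simp

theorem finsum_closedTerm_satisfiesRecurrence {z : K} (hz : z ≠ 0)
    (hq : ∀ m : ℕ, 0 < m → q ^ m ≠ 1) (hq0 : q ≠ 0) :
    SatisfiesRecurrence z q fun n => ∑ᶠ k, closedTerm z q n k := by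
  -- For `n ≤ 3` only the terms with `-1 ≤ k ≤ 1` contribute.
  have hsmall : ∀ n : ℕ, n ≤ 3 → ∑ᶠ k, closedTerm z q n k =
      closedTerm z q n (-1) + closedTerm z q n 0 + closedTerm z q n 1 := by
    intro n hn
    rw [finsum_eq_finsetSum_of_support_subset (s := {-1, 0, 1})]
    · rw [Finset.sum_insert (by decide), Finset.sum_insert (by decide), Finset.sum_singleton,
        add_assoc]
    · intro k hk
      by_contra h
      simp only [Finset.coe_insert, Finset.coe_singleton, Set.mem_insert_iff,
        Set.mem_singleton_iff] at h
      refine hk ?_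
      rw [closedTerm, qbin_eq_zero (by split_ifs <;> omega), mul_zero]
  have q0 : ∀ A : ℤ, 0 ≤ A → qbin q A 0 = 1 := fun A hA => qbin_zero_right hq hA
  have qs : ∀ A : ℤ, 0 ≤ A → qbin q A A = 1 := fun A hA => qbin_self hq hA
  have q21 : qbin q 2 1 = 1 + q := by
    have h := qbin_eq_add_zpow_sub_mul hq (A := 2) (by norm_num) 1
    norm_num at h
    rw [h, qs 1 (by norm_num), q0 1 (by norm_num), mul_one]
  have q31 : qbin q 3 1 = 1 + q + q ^ 2 := by
    have h := qbin_eq_add_zpow_sub_mul hq (A := 3) (by norm_num) 1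
    norm_num [zpow_ofNat] at h
    rw [h, q21, q0 2 (by norm_num), mul_one]
  have q32 : qbin q 3 2 = 1 + q + q ^ 2 := by
    have h := qbin_symm (q := q) 3 1
    norm_num at h
    rw [h, q31]
  have q41 : qbin q 4 1 = 1 + q + q ^ 2 + q ^ 3 := by
    have h := qbin_eq_add_zpow_sub_mul hq (A := 4) (by norm_num) 1
    norm_num [zpow_ofNat] at h
    rw [h, q31, q0 3 (by norm_num), mul_one]
  refine ⟨?_, ?_, ?_, ?_, finsum_closedTerm_recurrence hz hq hq0⟩
  · rw [hsmall 0 (by norm_num), closedTerm_of_odd z q (m := -1) (by norm_num),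
      closedTerm_of_even z q (m := 0) (by norm_num), closedTerm_of_odd z q (m := 0) (by norm_num)]
    norm_num [closedCoeff_zero, closedCoeff_one, closedCoeff_neg_one, qs, q0, qbin_eq_zero]
  · rw [hsmall 1 (by norm_num), closedTerm_of_even z q (m := 0) (by norm_num),
      closedTerm_of_odd z q (m := 0) (by norm_num), closedTerm_of_even z q (m := 1) (by norm_num)]
    norm_num [closedCoeff_zero, closedCoeff_one, closedCoeff_neg_one, qs, q0, qbin_eq_zero]
    ring
  · rw [hsmall 2 (by norm_num), closedTerm_of_odd z q (m := 0) (by norm_num),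
      closedTerm_of_even z q (m := 1) (by norm_num), closedTerm_of_odd z q (m := 1) (by norm_num)]
    norm_num [closedCoeff_zero, closedCoeff_one, closedCoeff_neg_one, qs, q0, q32, qbin_eq_zero]
    ring
  · rw [hsmall 3 (by norm_num), closedTerm_of_even z q (m := 1) (by norm_num),
      closedTerm_of_odd z q (m := 1) (by norm_num), closedTerm_of_even z q (m := 2) (by norm_num)]
    norm_num [closedCoeff_zero, closedCoeff_one, closedCoeff_neg_one, qs, q0, q32, q41,
      qbin_eq_zero]
    ring

lemma mainTerm_eq (z q : K) (n : ℕ) (k : ℤ) :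
    mainTerm z q n k = closedCoeff z q k * qbin q n (((n : ℤ) + 3 * k + 2) / 2) := rfl

lemma mainTerm_support_finite (z q : K) (n : ℕ) : (Function.support (mainTerm z q n)).Finite := by
  refine (Set.finite_Icc (-((n : ℤ) + 2)) ((n : ℤ) + 2)).subset fun k hk => ?_
  by_contra h
  rw [Set.mem_Icc] at h
  refine hk ?_
  rw [mainTerm, qbin_eq_zero (by omega), mul_zero]

lemma evenTerm_support_finite (z q : K) (n : ℕ) : (Function.support (evenTerm z q n)).Finite := by
  refine (Set.finite_Icc (-((n : ℤ) + 2)) ((n : ℤ) + 2)).subset fun k hk => ?_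
  by_contra h
  rw [Set.mem_Icc] at h
  refine hk ?_
  rw [evenTerm, qbin_eq_zero (by omega), mul_zero]

lemma oddTerm_support_finite (z q : K) (n : ℕ) : (Function.support (oddTerm z q n)).Finite := by
  refine (Set.finite_Icc (-((n : ℤ) + 2)) ((n : ℤ) + 2)).subset fun k hk => ?_
  by_contra h
  rw [Set.mem_Icc] at h
  refine hk ?_
  rw [oddTerm, qbin_eq_zero (by omega), mul_zero]

/-- A finite sum over `ℤ` of a function that vanishes off an arithmetic progression of
difference `2`. -/
lemma finsum_eq_finsum_two_mul_add {f : ℤ → K} (c : ℤ) (hf : ∀ k, Odd (k - c) → f k = 0) :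
    ∑ᶠ k, f k = ∑ᶠ j, f (2 * j + c) := by
  have hinj : Function.Injective fun j : ℤ => 2 * j + c := fun a b h => by
    simp only at h
    omega
  rw [← finsum_mem_range hinj, finsum_mem_def, Set.indicator_eq_self.mpr]
  intro k hk
  by_contra h
  refine hk (hf k (Int.not_even_iff_odd.mp fun ⟨j, hj⟩ => h ⟨j, ?_⟩))
  simp only
  omega

/-- For `q ≠ 0` the correction turns the Gaussian binomials `[n, _]` with `n + k` even into
`[n + 1, _]`, by the `q`-Pascal rule. -/
lemma closedTerm_sub_mainTerm (hq : ∀ m : ℕ, 0 < m → q ^ m ≠ 1) (z : K) {n : ℕ} {k m : ℤ}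
    (h : (n : ℤ) + k = 2 * m) :
    closedTerm z q n k - mainTerm z q n k =
      closedCoeff z q k * q ^ ((n : ℤ) - m - k) * qbin q n (m + k) := by
  rw [closedTerm_of_even z q h, mainTerm_eq, qbin_eq_add_zpow_sub_mul hq (by omega),
    show ((n : ℤ) + 3 * k + 2) / 2 = m + k + 1 by omega, add_sub_cancel_right, add_sub_cancel_right,
    show (n : ℤ) + 1 - (m + k + 1) = n - m - k by ring]
  ring

lemma finsum_closedTerm_eq (hq : ∀ m : ℕ, 0 < m → q ^ m ≠ 1) (hq0 : q ≠ 0) (z : K) (n : ℕ) :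
    ∑ᶠ k, closedTerm z q n k = (∑ᶠ k, mainTerm z q n k) + epsilonCorr z q n := by
  have hc : (Function.support (closedTerm z q n)).Finite :=
    (Finset.finite_toSet _).subset (closedTerm_support_subset z q n)
  rw [← sub_eq_iff_eq_add', ← finsum_sub_distrib hc (mainTerm_support_finite z q n)]
  have hodd : ∀ k, Odd ((n : ℤ) + k) → closedTerm z q n k - mainTerm z q n k = 0 := fun k hk => by
    rw [closedTerm, if_neg (Int.not_even_iff_odd.mpr hk), mainTerm_eq, sub_self]
  rw [epsilonCorr]
  split_ifs with hn
  · obtain ⟨m, rfl⟩ := hn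
    rw [finsum_eq_finsum_two_mul_add 0 fun k hk => hodd k (by
      rw [sub_zero] at hk
      push_cast
      exact (Even.add_self _).add_odd hk)]
    refine finsum_congr fun j => ?_
    have h2 := two_mul_pentagonal (2 * j)
    rw [add_zero, closedTerm_sub_mainTerm hq z (m := m + j) (by push_cast; ring), evenTerm,
      closedCoeff, Even.neg_one_zpow (even_two_mul j), one_mul, mul_assoc (z ^ _), ← zpow_add₀ hq0]
    congr 2
    · congr 1
      push_cast
      rw [show 2 * j * (3 * (2 * j) + 1) / 2 = 6 * j ^ 2 + j by linarith]
      omega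
    · push_cast
      omega
  · obtain ⟨m, rfl⟩ := Nat.not_even_iff_odd.mp hn
    rw [finsum_eq_finsum_two_mul_add 1 fun k hk => hodd k (by
      push_cast
      rw [show 2 * (m : ℤ) + 1 + k = 2 * (m + 1) + (k - 1) by ring]
      exact (even_two_mul _).add_odd hk), ← finsum_neg_distrib]
    refine finsum_congr fun j => ?_
    have h2 := two_mul_pentagonal (2 * j + 1)
    rw [closedTerm_sub_mainTerm hq z (m := m + j + 1) (by push_cast; ring), oddTerm,
      closedCoeff, Odd.neg_one_zpow (odd_two_mul_add_one j), neg_one_mul, neg_mul, neg_mul, neg_mul,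
      mul_assoc (z ^ _), ← zpow_add₀ hq0]
    congr 3
    · congr 1
      push_cast
      rw [show (2 * j + 1) * (3 * (2 * j + 1) + 1) / 2 = 6 * j ^ 2 + 7 * j + 2 by linarith]
      omega
    · push_cast
      omega

/-- At `q = 0` every Gaussian binomial is `0` or `1`, and exactly one term of the closed form
survives, namely the one of index `0`: in the correction if `n = 0`, in the main sum otherwise. -/
lemma finsum_mainTerm_add_epsilonCorr_of_zero (z : K) (n : ℕ) :
    (∑ᶠ k, mainTerm z 0 n k) + epsilonCorr z 0 n = 1 := by
  have hqbin : ∀ A B : ℤ, 0 ≤ B ∧ B ≤ A → qbin (0 : K) A B = 1 := fun A B h => by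
    simp [qbin, if_pos h, qPoch]
  have hpent : ∀ k : ℤ, k ≠ 0 → k * (3 * k + 1) / 2 ≠ 0 := fun k hk h => by
    have h2 := two_mul_pentagonal k
    rw [h, mul_zero, eq_comm, mul_eq_zero] at h2
    omega
  have hmain : ∑ᶠ k, mainTerm z 0 n k = qbin 0 (n : ℤ) (((n : ℤ) + 2) / 2) := by
    rw [finsum_eq_single _ 0 fun k hk => ?_]
    · simp [mainTerm]
    · rw [mainTerm, zero_zpow _ (hpent k hk), mul_zero, zero_mul]
  have hsq : ∀ j : ℤ, j ≠ 0 → 1 ≤ j ^ 2 ∧ |j| ≤ j ^ 2 := fun j hj =>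
    ⟨Int.add_one_le_iff.mpr (sq_pos_iff.mpr hj), by rw [← sq_abs]; nlinarith [abs_pos.mpr hj]⟩
  rcases Nat.eq_zero_or_pos n with rfl | hn
  · rw [hmain, qbin_eq_zero (by norm_num), epsilonCorr, if_pos (by decide),
      finsum_eq_single _ 0 fun j hj => ?_]
    · simp [evenTerm, hqbin 0 0]
    · have := hsq j hj
      have := le_abs_self j
      rw [evenTerm, zero_zpow _ (by omega), mul_zero, zero_mul]
  · rw [hmain, hqbin _ _ (by omega), add_eq_left, epsilonCorr]
    have key : ∀ j : ℤ, 0 ≤ 6 * j ^ 2 - 2 * j ∧ 0 ≤ 6 * j ^ 2 + 4 * j := fun j => by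
      rcases eq_or_ne j 0 with rfl | hj
      · norm_num
      · have := hsq j hj
        have := le_abs_self j
        have := neg_abs_le j
        constructor <;> linarith
    split_ifs with h
    · refine finsum_eq_zero_of_forall_eq_zero fun j => ?_
      obtain ⟨m, rfl⟩ := h
      have := key j
      rw [evenTerm, zero_zpow _ (by omega), mul_zero, zero_mul]
    · rw [neg_eq_zero]
      refine finsum_eq_zero_of_forall_eq_zero fun j => ?_
      have := key j
      rw [oddTerm, zero_zpow _ (by omega), mul_zero, zero_mul]

theorem closedForm_satisfiesRecurrence {z : K} (hz : z ≠ 0) (hq : ∀ m : ℕ, 0 < m → q ^ m ≠ 1) :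
    SatisfiesRecurrence z q fun n => (∑ᶠ k, mainTerm z q n k) + epsilonCorr z q n := by
  rcases eq_or_ne q 0 with rfl | hq0
  · simp only [finsum_mainTerm_add_epsilonCorr_of_zero]
    constructor <;> simp
  · simp only [← finsum_closedTerm_eq hq hq0]
    exact finsum_closedTerm_satisfiesRecurrence hz hq hq0

end ClosedForm

/-! ### Uniqueness and conclusion -/

/-- A sequence satisfying the recurrence is determined, since the recurrence expresses `P (n + 4)`
through the four preceding terms. -/
lemma SatisfiesRecurrence.unique {K : Type*} [Field K] {z q : K} {P Q : ℕ → K}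
    (hP : SatisfiesRecurrence z q P) (hQ : SatisfiesRecurrence z q Q) (n : ℕ) : P n = Q n := by
  induction n using Nat.strong_induction_on with
  | _ n ih =>
    match n, ih with
    | 0, _ => rw [hP.init0, hQ.init0]
    | 1, _ => rw [hP.init1, hQ.init1]
    | 2, _ => rw [hP.init2, hQ.init2]
    | 3, _ => rw [hP.init3, hQ.init3]
    | n + 4, ih =>
      rw [hP.recur, hQ.recur, ih (n + 3) (by omega), ih (n + 2) (by omega), ih (n + 1) (by omega),
        ih n (by omega)]

theorem mainTheorem2 {K : Type*} [Field K] (z q : K) (hz : z ≠ 0)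
    (hq : ∀ m : ℕ, 0 < m → q ^ m ≠ 1) :
    (∀ n : ℕ,
      (Function.support (mainTerm z q n)).Finite ∧
      (Even n → (Function.support (evenTerm z q n)).Finite) ∧
      (Odd n → (Function.support (oddTerm z q n)).Finite) ∧
      tripleSum z q n = (∑ᶠ j : ℤ, mainTerm z q n j) + epsilonCorr z q n) ∧
    (∀ P : ℕ → K, SatisfiesRecurrence z q P ↔ ∀ n : ℕ, P n = tripleSum z q n) := by
  have hT := tripleSum_satisfiesRecurrence hz hq
  refine ⟨fun n => ⟨mainTerm_support_finite z q n, fun _ => evenTerm_support_finite z q n,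
    fun _ => oddTerm_support_finite z q n, hT.unique (closedForm_satisfiesRecurrence hz hq) n⟩,
    fun P => ⟨fun hP => hP.unique hT, fun h => ?_⟩⟩
  rw [funext h]
  exact hT
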